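/- All spaces are Hausdorff, and the field of scalars $\mathbb{F}$ is either $\mathbb{R}$ or $\mathbb{C}$. For a space $Z$, let $C_b(Z)$ be the algebra of all bounded continuous functions $f\colon Z\to\mathbb{F}$ with the supremum norm, let $\operatorname{supp}(f)$ be the closure in $Z$ of $\{z\in Z: f(z)\neq 0\}$, let $C_0(Z)$ be the set of all $f\in C_b(Z)$ that vanish at infinity (that is, $\{z\in Z:|f(z)|\ge\varepsilon\}$ is compact for every $\varepsilon>0$), and let $C_{00}(Z)$ be the set of all $f\in C_b(Z)$ with compact support. **Theorem 5.2.** Let $X$ be a locally compact metrizable space and let $$C_\sigma(X)=\{f\in C_b(X): \operatorname{supp}(f)\text{ is }\sigma\text{-compact}\}.$$ Then $C_\sigma(X)$ is a (not necessarily unital) subalgebra of $C_b(X)$ that is complete in the supremum norm, so it is a Banach algebra, and it is isometrically isomorphic, as a Banach algebra, to $C_0(Y)$ for some locally compact Hausdorff space $Y$. The space $Y$ is unique up to homeomorphism: every locally compact Hausdorff space $Z$ for which $C_\sigma(X)$ is isometrically isomorphic, as a Banach algebra, to $C_0(Z)$ is homeomorphic to $Y$. The space $Y$ is countably compact, $C_0(Y)=C_{00}(Y)$,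 and if $X$ is not $\sigma$-compact, then $Y$ is not normal. -/

import Mathlib

open scoped BoundedContinuousFunction ZeroAtInfty

universe u v w

/-- `C_σ(X)`: the bounded continuous `𝕜`-valued functions on `X` whose support (the closure of
the set where the function is nonzero) is `σ`-compact. -/
def CSigma (𝕜 X : Type*) [RCLike 𝕜] [TopologicalSpace X] : Set (X →ᵇ 𝕜) :=
  {f | IsSigmaCompact (tsupport f)}

/-- `C_00(Y)`: the bounded continuous `𝕜`-valued functions on `Y` with compact support. -/
def CCompactSupport (𝕜 Y : Type*) [RCLike 𝕜] [TopologicalSpace Y] : Set (Y →ᵇ 𝕜) :=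
  {f | IsCompact (tsupport f)}

/-- `C_0(Y)` as a subset of the bounded continuous functions on `Y`. -/
def CZeroAtInfty (𝕜 Y : Type*) [RCLike 𝕜] [TopologicalSpace Y] : Set (Y →ᵇ 𝕜) :=
  Set.range (ZeroAtInftyContinuousMap.toBCF : C₀(Y, 𝕜) → (Y →ᵇ 𝕜))

/-- A (possibly non-unital) subalgebra of a normed algebra is a normed space under the inherited
norm. -/
instance nonUnitalSubalgebraNormedSpace {𝕜 E : Type*} [NormedField 𝕜] [NonUnitalNormedRing E]
    [NormedSpace 𝕜 E] (A : NonUnitalSubalgebra 𝕜 E) : NormedSpace 𝕜 A where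
  norm_smul_le c f := norm_smul_le c (f : E)

/-- Two (possibly non-unital) normed algebras are isometrically isomorphic: there is a bijective
isometric homomorphism of `𝕜`-algebras (not required to respect units) between them. -/
def IsometricallyIsomorphic (𝕜 A B : Type*) [RCLike 𝕜] [NonUnitalNormedRing A] [NormedSpace 𝕜 A]
    [NonUnitalNormedRing B] [NormedSpace 𝕜 B] : Prop :=
  ∃ φ : A →ₙₐ[𝕜] B, Function.Bijective φ ∧ Isometry φ

/-! Paracompactness splits `X` into clopen `σ`-compact fibres of a map `q : X → I`. A `σ`-compact
set meets only countably many fibres, so `C_σ(X)` consists of the bounded continuous functions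
living on `q ⁻¹' J` for some countable `J` (`mem_cSigma_iff`). Hence `Y` is `countableHull q`, the
union in the Stone–Čech compactification of the compact open hulls of these sets, and restriction
from `Y` to `X` is the isomorphism. Countable unions of countable sets are countable, so a sequence
in `Y`, or the nonzero set of a function in `C₀(Y)`, lies in a single compact hull; this gives
countable compactness and `C₀ = C₀₀`. Uniqueness holds because nonzero characters of `C₀(Y)` are
point evaluations.

If `X` is not `σ`-compact, `I` is uncountable. Coherent finite-to-one functions on the countable
ordinals have graphs that no single set matches modulo finite sets. In the remote part of `Y`, where
finite sets are invisible, the graphs and their complements give two disjoint closed sets; open sets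
separating them would produce such a matching set. -/

section

open Set Filter Topology

/-! ### Coherent families on the countable ordinals -/

/-- There are functions `e a`, finite-to-one below `a`, that cohere modulo finite sets. -/
theorem exists_coherent_finite_to_one (W : Type*) [LinearOrder W] [WellFoundedLT W]
    (hW : ∀ a : W, (Iio a).Countable) :
    ∃ e : W → W → ℕ, (∀ a n, {x | x < a ∧ e a x ≤ n}.Finite) ∧
      ∀ a b, {x | x < a ∧ x < b ∧ e a x ≠ e b x}.Finite := by
  classical
  have hs : ∀ a : W, ∃ s : ℕ → W, Iio a ⊆ range s := fun a => by
    obtain ⟨s, hs⟩ := ((hW a).insert a).exists_eq_range (insert_nonempty _ _)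
    exact ⟨s, hs ▸ subset_insert _ _⟩
  choose s hs using hs
  -- Recursion along enumerations `s a` of the predecessors of `a`: step from `a` to the first
  -- listed predecessor that is at least `x`. The index `k` of that step enters a maximum, so a
  -- bound on `e a x` leaves finitely many choices of `k`.
  let F : (a : W) → ((b : W) → b < a → W → ℕ) → W → ℕ := fun a rec x =>
    if h : ∃ k, s a k < a ∧ x ≤ s a k then
      max (Nat.find h) (rec (s a (Nat.find h)) (Nat.find_spec h).1 x) else 0
  let e : W → W → ℕ := wellFounded_lt.fix F
  have he : ∀ a x, x < a → ∃ k, s a k < a ∧ x ≤ s a k ∧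
      (∀ j, s a j < a → x ≤ s a j → k ≤ j) ∧ e a x = max k (e (s a k) x) := by
    intro a x hx
    have h : ∃ k, s a k < a ∧ x ≤ s a k := by
      obtain ⟨k, rfl⟩ := hs a hx
      exact ⟨k, hx, le_rfl⟩
    refine ⟨Nat.find h, (Nat.find_spec h).1, (Nat.find_spec h).2,
      fun j h₁ h₂ => Nat.find_min' h ⟨h₁, h₂⟩, ?_⟩
    have : e a = F a fun b _ => e b := wellFounded_lt.fix_eq F a
    rw [this]
    simp only [F, dif_pos h]
  have key : ∀ a, (∀ n, {x | x < a ∧ e a x ≤ n}.Finite) ∧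
      ∀ b < a, {x | x < b ∧ e a x ≠ e b x}.Finite := by
    intro a
    induction a using WellFoundedLT.induction with | ind a ih =>
    have ih' : ∀ b c, b < a → c < a → {x | x < b ∧ x < c ∧ e b x ≠ e c x}.Finite := by
      intro b c hb hc
      rcases lt_trichotomy b c with h | rfl | h
      · exact ((ih c hc).2 b h).subset fun x hx => ⟨hx.1, hx.2.2.symm⟩
      · simp
      · exact ((ih b hb).2 c h).subset fun x hx => ⟨hx.2.1, hx.2.2⟩
    refine ⟨fun n => ?_, fun b hb => ?_⟩
    · have : (⋃ k ∈ Iic n, {x | s a k < a ∧ (x = s a k ∨ x < s a k ∧ e (s a k) x ≤ n)}).Finite := by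
        refine (finite_Iic n).biUnion fun k _ => ?_
        by_cases hk : s a k < a
        · refine (((ih _ hk).1 n).insert (s a k)).subset ?_
          rintro x ⟨-, h | h⟩
          exacts [Or.inl h, Or.inr h]
        · simp [hk]
      refine this.subset ?_
      rintro x ⟨hx, hn⟩
      obtain ⟨k, hk, hxk, -, h⟩ := he a x hx
      rw [h, max_le_iff] at hn
      simp only [mem_iUnion]
      exact ⟨k, hn.1, hk, hxk.eq_or_lt.imp id fun h => ⟨h, hn.2⟩⟩
    · obtain ⟨n, rfl⟩ := hs a hb
      -- For `x < b = s a n` the step index is at most `n`. Unless `e (s a k) x ≤ k`, the maximum is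
      -- `e (s a k) x`, which agrees with `e b x` up to finitely many `x` by induction.
      have : (⋃ k ∈ Iic n, {x | s a k < a ∧ (x = s a k ∨ x < s a k ∧ e (s a k) x ≤ k ∨
          (x < s a k ∧ x < s a n ∧ e (s a k) x ≠ e (s a n) x))}).Finite := by
        refine (finite_Iic n).biUnion fun k _ => ?_
        by_cases hk : s a k < a
        · refine ((((ih _ hk).1 k).union (ih' _ _ hk hb)).insert (s a k)).subset ?_
          rintro x ⟨-, h | h | h⟩
          exacts [Or.inl h, Or.inr (Or.inl h), Or.inr (Or.inr h)]
        · simp [hk]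
      refine this.subset ?_
      rintro x ⟨hx, hne⟩
      obtain ⟨k, hk, hxk, hmin, h⟩ := he a x (hx.trans hb)
      simp only [mem_iUnion]
      refine ⟨k, hmin n hb hx.le, hk, hxk.eq_or_lt.imp id fun hlt => ?_⟩
      by_cases hle : e (s a k) x ≤ k
      · exact Or.inl ⟨hlt, hle⟩
      · exact Or.inr ⟨hlt, hx, by rwa [h, max_eq_right (not_le.1 hle).le] at hne⟩
  refine ⟨e, fun a => (key a).1, fun a b => ?_⟩
  rcases lt_trichotomy a b with h | rfl | h
  · exact ((key b).2 a h).subset fun x hx => ⟨hx.1, hx.2.2.symm⟩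
  · simp
  · exact ((key a).2 b h).subset fun x hx => ⟨hx.2.1, hx.2.2⟩

/-- Subsets `G a` of the sets `N a` that agree on the overlaps modulo finite sets. -/
structure AlmostCoherent {W I : Type*} (N G : W → Set I) : Prop where
  subset : ∀ a, G a ⊆ N a
  finite_diff : ∀ a b, ((G a ∩ N b) \ G b).Finite

theorem AlmostCoherent.sdiff {W I : Type*} {N G : W → Set I} (h : AlmostCoherent N G) :
    AlmostCoherent N fun a => N a \ G a where
  subset _ := sdiff_subset
  finite_diff a b := (h.finite_diff b a).subset fun _ hx =>
    ⟨⟨by_contra fun hG => hx.2 ⟨hx.1.2, hG⟩, hx.1.1.1⟩, hx.1.1.2⟩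

/-- Every uncountable set carries an almost coherent family of subsets of countable sets that is
not induced, modulo finite sets, by a single set. -/
theorem exists_almostCoherent_not_uniformizable (I : Type u) [Uncountable I] :
    ∃ (W : Type u) (N G : W → Set I), (∀ a, (N a).Countable) ∧
      (∀ J : Set I, J.Countable → ∃ a, ∀ b, J ∩ N b ⊆ N a) ∧ AlmostCoherent N G ∧
      ∀ A : Set I, ∃ a, ¬ ((G a \ A).Finite ∧ ((N a \ G a) ∩ A).Finite) := by
  classical
  let W : Type u := (Cardinal.aleph 1).ord.ToType
  have hWc : Cardinal.mk W = Cardinal.aleph 1 := by simp [W]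
  have hW : ∀ a : W, (Iio a).Countable := fun a => by
    rw [← Cardinal.le_aleph0_iff_set_countable, ← Cardinal.lt_aleph_one_iff]
    exact (Cardinal.mk_Iio_lt a (by simp [W])).trans_eq hWc
  have : Uncountable W := by
    rw [← Cardinal.aleph0_lt_mk_iff, hWc]
    exact Cardinal.aleph0_lt_aleph_one
  have hbdd : ∀ T : Set W, T.Countable → ∃ a, T ⊆ Iio a := by
    intro T hT
    by_contra! h
    refine not_countable_univ (α := W) ((hT.biUnion fun t _ => (hW t).insert t).mono fun a _ => ?_)
    obtain ⟨t, ht, hta⟩ := not_subset.1 (h a)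
    simp only [mem_iUnion]
    exact ⟨t, ht, (not_lt.1 hta).eq_or_lt⟩
  have hcard : Cardinal.mk (W × ℕ) ≤ Cardinal.mk I := by
    rw [Cardinal.mk_prod, hWc]
    simp
  obtain ⟨c⟩ := Cardinal.le_def _ _ |>.1 hcard
  obtain ⟨e, hfin, hcoh⟩ := exists_coherent_finite_to_one W hW
  refine ⟨W, fun a => c '' {p | p.1 < a}, fun a => c '' {p | p.1 < a ∧ p.2 = e a p.1},
    fun a => ?_, fun J hJ => ?_, ⟨fun a => image_mono fun p hp => hp.1, fun a b => ?_⟩,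
    fun A => ?_⟩
  · refine (((hW a).prod countable_univ).mono fun p hp => ?_).image c
    exact ⟨hp, mem_univ (p.2 : ℕ)⟩
  · obtain ⟨a, ha⟩ := hbdd (Prod.fst '' (c ⁻¹' J)) ((hJ.preimage c.injective).image _)
    refine ⟨a, fun b => ?_⟩
    rintro _ ⟨hx, p, -, rfl⟩
    exact ⟨p, ha ⟨p, hx, rfl⟩, rfl⟩
  · refine ((hcoh a b).image fun x => c (x, e a x)).subset ?_
    rintro _ ⟨⟨⟨⟨x, n⟩, ⟨hxa, hn⟩, rfl⟩, hN⟩, hG⟩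
    simp only [c.injective.mem_set_image, mem_ofPred_eq, not_and] at hN hG hxa hn
    subst hn
    exact ⟨x, ⟨hxa, hN, hG hN⟩, rfl⟩
  · by_contra! h
    -- An uncountable level `n` of `A` would contain infinitely many points below some `a`; as `e a`
    -- is finite-to-one, almost all of them are off its graph.
    have hslice : ∀ n, {x | c (x, n) ∈ A}.Countable := by
      intro n
      by_contra hn
      have hinf : {x | c (x, n) ∈ A}.Infinite := fun hf => hn hf.countable
      obtain ⟨T, hTA, hTinf, hTc⟩ :
          ∃ T ⊆ {x | c (x, n) ∈ A}, T.Infinite ∧ T.Countable := by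
        let f := hinf.natEmbedding
        exact ⟨range fun k => (f k : W), by rintro _ ⟨k, rfl⟩; exact (f k).2,
          infinite_range_of_injective (Subtype.val_injective.comp f.injective),
          countable_range _⟩
      obtain ⟨a, ha⟩ := hbdd T hTc
      refine hTinf (((hfin a n).union (((h a).2).preimage
        (c.injective.comp (Prod.mk_left_injective n)).injOn)).subset fun x hx => ?_)
      by_cases hxe : e a x ≤ n
      · exact Or.inl ⟨ha hx, hxe⟩
      · refine Or.inr ⟨⟨⟨_, ha hx, rfl⟩, ?_⟩, hTA hx⟩
        simp only [Function.comp_apply, c.injective.mem_set_image, mem_ofPred_eq, not_and]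
        exact fun _ h => hxe h.ge
    -- All levels of `A` now lie below one `a`, so `A` misses the graph of `e b` over the infinitely
    -- many points chosen between `a` and `b`.
    obtain ⟨a, ha⟩ := hbdd _ (countable_iUnion hslice)
    have hinf : (Iio a)ᶜ.Infinite := fun hf =>
      not_countable_univ (α := W) (by
        rw [← union_compl_self (Iio a)]
        exact (hW a).union hf.countable)
    let f := hinf.natEmbedding
    obtain ⟨b, hb⟩ := hbdd (range fun k => (f k : W)) (countable_range _)
    have hinj : Function.Injective fun k => c ((f k : W), e b (f k)) := fun k l hkl =>
      f.injective (Subtype.ext (congrArg Prod.fst (c.injective hkl)))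
    refine infinite_range_of_injective hinj ((h b).1.subset ?_)
    rintro _ ⟨k, rfl⟩
    refine ⟨⟨_, ⟨hb ⟨k, rfl⟩, rfl⟩, rfl⟩, fun hA => (f k).2 (ha (mem_iUnion.2 ⟨_, hA⟩))⟩

/-! ### Partition into `σ`-compact clopen pieces -/

/-- A locally compact paracompact Hausdorff space is partitioned by `σ`-compact open sets. -/
theorem exists_isLocallyConstant_isSigmaCompact_fiber (X : Type u) [TopologicalSpace X]
    [T2Space X] [LocallyCompactSpace X] [ParacompactSpace X] :
    ∃ (I : Type u) (q : X → I), IsLocallyConstant q ∧ Function.Surjective q ∧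
      ∀ i, IsSigmaCompact (q ⁻¹' {i}) := by
  have hK : ∀ x : X, ∃ K : Set X, IsCompact K ∧ x ∈ interior K := fun x => by
    simpa only [mem_interior_iff_mem_nhds] using exists_compact_mem_nhds x
  choose K hK hxK using hK
  obtain ⟨U, hUo, hUc, hUf, hUK⟩ := precise_refinement (fun x => interior (K x))
    (fun _ => isOpen_interior) (iUnion_eq_univ_iff.2 fun x => ⟨x, hxK x⟩)
  have hUcl : ∀ i, IsCompact (closure (U i)) := fun i =>
    (hK i).of_isClosed_subset isClosed_closure
      (closure_minimal ((hUK i).trans interior_subset) (hK i).isClosed)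
  -- The pieces are the classes of chains of overlapping `U i`. A class is exhausted by iterated
  -- stars of a point, and by local finiteness only countably many `U i` meet a `σ`-compact set.
  let r : X → X → Prop := fun x y => ∃ i, x ∈ U i ∧ y ∈ U i
  let S : Setoid X := Relation.EqvGen.setoid r
  have hrS : ∀ {x y}, r x y → (Quotient.mk S x) = Quotient.mk S y := fun h =>
    Quotient.sound (Relation.EqvGen.rel _ _ h)
  have hcov : ∀ x, ∃ i, x ∈ U i := iUnion_eq_univ_iff.1 hUc
  have hloc : IsLocallyConstant (Quotient.mk S) := by
    refine (IsLocallyConstant.iff_exists_open _).2 fun x => ?_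
    obtain ⟨i, hi⟩ := hcov x
    exact ⟨U i, hUo i, hi, fun y hy => hrS ⟨i, hy, hi⟩⟩
  refine ⟨Quotient S, Quotient.mk S, hloc, Quotient.mk_surjective, fun i => ?_⟩
  obtain ⟨x, rfl⟩ := Quotient.mk_surjective i
  let star : Set X → Set X := fun T => ⋃ i ∈ {i | (U i ∩ T).Nonempty}, closure (U i)
  have hstar : ∀ T, IsSigmaCompact T → IsSigmaCompact (star T) := by
    rintro T ⟨C, hC, rfl⟩
    refine isSigmaCompact_biUnion ?_ fun i _ => (hUcl i).isSigmaCompact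
    refine (countable_iUnion fun n => (hUf.finite_nonempty_inter_compact (hC n)).countable).mono ?_
    rintro i ⟨y, hy, hyC⟩
    obtain ⟨n, hn⟩ := mem_iUnion.1 hyC
    exact mem_iUnion.2 ⟨n, y, hy, hn⟩
  let T : ℕ → Set X := fun n => star^[n] {x}
  have hT : ∀ n, IsSigmaCompact (T n) := by
    intro n
    induction n with
    | zero => exact isCompact_singleton.isSigmaCompact
    | succ n ih => simpa only [T, Function.iterate_succ_apply'] using hstar _ ih
  have hstep : ∀ {y z}, r y z → y ∈ ⋃ n, T n → z ∈ ⋃ n, T n := by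
    rintro y z ⟨i, hy, hz⟩ h
    obtain ⟨n, hn⟩ := mem_iUnion.1 h
    refine mem_iUnion.2 ⟨n + 1, ?_⟩
    simp only [T, Function.iterate_succ_apply']
    exact mem_biUnion (show i ∈ {i | (U i ∩ T n).Nonempty} from ⟨y, hy, hn⟩) (subset_closure hz)
  have hiff : ∀ y z, Relation.EqvGen r y z → (y ∈ ⋃ n, T n ↔ z ∈ ⋃ n, T n) := by
    intro y z h
    induction h with
    | rel y z h => exact ⟨hstep h, hstep (h.imp fun _ => And.symm)⟩
    | refl => rfl
    | symm _ _ _ ih => exact ih.symm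
    | trans _ _ _ _ _ ih₁ ih₂ => exact ih₁.trans ih₂
  refine (isSigmaCompact_iUnion T hT).of_isClosed_subset
    (hloc.isClosed_fiber _) fun y hy => ?_
  exact (hiff x y (Quotient.exact (Eq.symm hy))).1 (mem_iUnion.2 ⟨0, rfl⟩)

section Partition

variable {X I : Type*} [TopologicalSpace X] {q : X → I}

theorem IsSigmaCompact.countable_image_of_isLocallyConstant (hq : IsLocallyConstant q)
    {s : Set X} (hs : IsSigmaCompact s) : (q '' s).Countable := by
  let : TopologicalSpace I := ⊥
  have : DiscreteTopology I := ⟨rfl⟩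
  obtain ⟨C, hC, rfl⟩ := hs
  rw [image_iUnion]
  exact countable_iUnion fun n => ((hC n).image hq.continuous).finite_of_discrete.countable

theorem isSigmaCompact_preimage_of_countable (hσ : ∀ i, IsSigmaCompact (q ⁻¹' {i}))
    {J : Set I} (hJ : J.Countable) : IsSigmaCompact (q ⁻¹' J) := by
  rw [← biUnion_preimage_singleton]
  exact isSigmaCompact_biUnion hJ fun i _ => hσ i

end Partition

/-! ### Hulls in the Stone–Čech compactification -/

/-- The closure in the Stone–Čech compactification of a subset of the space. -/
def stoneCechHull {X : Type*} [TopologicalSpace X] (s : Set X) : Set (StoneCech X) :=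
  closure (stoneCechUnit '' s)

section Hull

variable {X : Type*} [TopologicalSpace X] {s t : Set X}

theorem stoneCechHull_mono (h : s ⊆ t) : stoneCechHull s ⊆ stoneCechHull t :=
  closure_mono (image_mono h)

theorem stoneCechHull_union : stoneCechHull (s ∪ t) = stoneCechHull s ∪ stoneCechHull t := by
  simp only [stoneCechHull, image_union, closure_union]

theorem stoneCechUnit_mem_hull {x : X} (hx : x ∈ s) : stoneCechUnit x ∈ stoneCechHull s :=
  subset_closure (mem_image_of_mem _ hx)

theorem isCompact_stoneCechHull : IsCompact (stoneCechHull s) :=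
  isClosed_closure.isCompact

theorem isClopen_stoneCechHull_and_mem_iff (hs : IsClopen s) :
    IsClopen (stoneCechHull s) ∧ ∀ x, stoneCechUnit x ∈ stoneCechHull s ↔ x ∈ s := by
  classical
  have hf : Continuous fun x => decide (x ∈ s) :=
    continuous_bool_rng true |>.2 (by convert hs using 1; ext; simp)
  have hF := continuous_stoneCechExtend hf
  have hU : ∀ x, stoneCechExtend hf (stoneCechUnit x) = decide (x ∈ s) :=
    stoneCechExtend_stoneCechUnit hf
  have hO : IsClopen (stoneCechExtend hf ⁻¹' {true}) := (isClopen_discrete _).preimage hF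
  have : stoneCechHull s = stoneCechExtend hf ⁻¹' {true} := by
    refine (closure_minimal ?_ hO.isClosed).antisymm ?_
    · rintro _ ⟨x, hx, rfl⟩
      simpa [hU] using hx
    · refine (denseRange_stoneCechUnit.open_subset_closure_inter hO.isOpen).trans
        (closure_mono ?_)
      rintro _ ⟨hx, x, rfl⟩
      exact ⟨x, by simpa [hU] using hx, rfl⟩
  rw [this]
  exact ⟨hO, fun x => by simp [hU]⟩

theorem isClopen_stoneCechHull (hs : IsClopen s) : IsClopen (stoneCechHull s) :=
  (isClopen_stoneCechHull_and_mem_iff hs).1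

theorem stoneCechUnit_mem_hull_iff (hs : IsClopen s) {x : X} :
    stoneCechUnit x ∈ stoneCechHull s ↔ x ∈ s :=
  (isClopen_stoneCechHull_and_mem_iff hs).2 x

theorem stoneCechHull_inter_subset (hs : IsClopen s) :
    stoneCechHull s ∩ stoneCechHull t ⊆ stoneCechHull (s ∩ t) := by
  refine ((isClopen_stoneCechHull hs).isOpen.inter_closure).trans (closure_mono ?_)
  rintro _ ⟨hx, x, hxt, rfl⟩
  exact ⟨x, ⟨(stoneCechUnit_mem_hull_iff hs).1 hx, hxt⟩, rfl⟩

end Hull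

/-! ### The space `Y` -/

/-- The points of the Stone–Čech compactification of `X` that lie in the closure of the preimage
under `q` of a countable set. -/
def countableHull {X I : Type*} [TopologicalSpace X] (q : X → I) : Set (StoneCech X) :=
  {p | ∃ J : Set I, J.Countable ∧ p ∈ stoneCechHull (q ⁻¹' J)}

section CountableHull

variable {X I : Type*} [TopologicalSpace X] {q : X → I}

/-- The canonical map of `X` into the countable hull. -/
def countableHullUnit (q : X → I) (x : X) : countableHull q :=
  ⟨stoneCechUnit x, {q x}, countable_singleton _, stoneCechUnit_mem_hull rfl⟩

theorem continuous_countableHullUnit : Continuous (countableHullUnit q) :=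
  continuous_stoneCechUnit.subtype_mk _

theorem IsLocallyConstant.isClopen_preimage (hq : IsLocallyConstant q) (J : Set I) :
    IsClopen (q ⁻¹' J) :=
  ⟨⟨hq Jᶜ⟩, hq J⟩

theorem isOpen_countableHull (hq : IsLocallyConstant q) : IsOpen (countableHull q) := by
  refine isOpen_iff_mem_nhds.2 fun p ⟨J, hJ, hp⟩ => mem_of_superset
    ((isClopen_stoneCechHull (hq.isClopen_preimage J)).isOpen.mem_nhds hp) fun p hp => ⟨J, hJ, hp⟩

theorem isCompact_coe_preimage_hull {J : Set I} (hJ : J.Countable) :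
    IsCompact ((↑) ⁻¹' stoneCechHull (q ⁻¹' J) : Set (countableHull q)) := by
  have h : stoneCechHull (q ⁻¹' J) ⊆ countableHull q := fun p hp => ⟨J, hJ, hp⟩
  rw [Subtype.isCompact_iff, Subtype.image_preimage_coe, inter_eq_right.2 h]
  exact isCompact_stoneCechHull

theorem isClopen_coe_preimage_hull (hq : IsLocallyConstant q) (J : Set I) :
    IsClopen ((↑) ⁻¹' stoneCechHull (q ⁻¹' J) : Set (countableHull q)) :=
  (isClopen_stoneCechHull (hq.isClopen_preimage J)).preimage continuous_subtype_val

theorem denseRange_countableHullUnit (hq : IsLocallyConstant q) :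
    DenseRange (countableHullUnit q) := by
  refine dense_iff_inter_open.2 fun U hU ⟨y, hy⟩ => ?_
  obtain ⟨_, ⟨p, hpU, rfl⟩, x, hp⟩ := dense_iff_inter_open.1 denseRange_stoneCechUnit _
    ((isOpen_countableHull hq).isOpenMap_subtype_val U hU) ⟨_, y, hy, rfl⟩
  exact ⟨p, hpU, x, Subtype.ext hp⟩

theorem exists_countable_forall_mem_hull {ι : Type*} [Countable ι] (y : ι → countableHull q) :
    ∃ J : Set I, J.Countable ∧ ∀ n, (y n : StoneCech X) ∈ stoneCechHull (q ⁻¹' J) := by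
  choose J hJ hy using fun n => (y n).2
  exact ⟨⋃ n, J n, countable_iUnion hJ, fun n =>
    stoneCechHull_mono (preimage_mono (subset_iUnion J n)) (hy n)⟩

theorem exists_countable_subset_of_isCompact (hq : IsLocallyConstant q)
    {C : Set (countableHull q)} (hC : IsCompact C) :
    ∃ J : Set I, J.Countable ∧ C ⊆ (↑) ⁻¹' stoneCechHull (q ⁻¹' J) := by
  refine hC.induction_on ⟨∅, countable_empty, empty_subset _⟩
    (fun _ _ h ⟨J, hJ, h'⟩ => ⟨J, hJ, h.trans h'⟩)
    (fun _ _ ⟨J, hJ, h⟩ ⟨J', hJ', h'⟩ => ⟨J ∪ J', hJ.union hJ', ?_⟩) fun y _ => ?_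
  · rw [preimage_union, stoneCechHull_union, preimage_union]
    exact union_subset_union h h'
  · obtain ⟨J, hJ, hy⟩ := y.2
    exact ⟨_, mem_nhdsWithin_of_mem_nhds
      ((isClopen_coe_preimage_hull hq J).isOpen.mem_nhds hy), J, hJ, Subset.rfl⟩

theorem countablyCompactSpace_countableHull : CountablyCompactSpace (countableHull q) := by
  refine isCountablyCompact_univ_iff.1 (isCountablyCompact_iff_seq_clusterPt.2 fun y _ => ?_)
  obtain ⟨J, hJ, hy⟩ := exists_countable_forall_mem_hull y
  obtain ⟨a, -, ha⟩ := (isCompact_coe_preimage_hull hJ).exists_clusterPt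
    (f := map y atTop) (le_principal_iff.2 (mem_map.2 (Eventually.of_forall hy)))
  exact ⟨a, mem_univ _, ha⟩

/-! ### Remote points and failure of normality -/

/-- The points of the countable hull that are in the hull of no finite subset of `I`. -/
def remoteHull (q : X → I) : Set (countableHull q) :=
  {y | ∀ F : Set I, F.Finite → (y : StoneCech X) ∉ stoneCechHull (q ⁻¹' F)}

theorem isClosed_remoteHull (hq : IsLocallyConstant q) : IsClosed (remoteHull q) := by
  simp only [remoteHull, ofPred_forall]
  exact isClosed_iInter fun F => isClosed_iInter fun _ =>
    (isClopen_coe_preimage_hull hq F).compl.isClosed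

theorem mem_hull_of_finite_diff {J K : Set I} {y : countableHull q} (hy : y ∈ remoteHull q)
    (hJ : (y : StoneCech X) ∈ stoneCechHull (q ⁻¹' J)) (hJK : (J \ K).Finite) :
    (y : StoneCech X) ∈ stoneCechHull (q ⁻¹' K) := by
  have := stoneCechHull_mono (preimage_mono (f := q) (subset_sdiff_union J K)) hJ
  rw [preimage_union, stoneCechHull_union] at this
  exact this.resolve_left (hy _ hJK)

theorem inter_mem_hull (hq : IsLocallyConstant q) {J K : Set I} {p : StoneCech X}
    (hJ : p ∈ stoneCechHull (q ⁻¹' J)) (hK : p ∈ stoneCechHull (q ⁻¹' K)) :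
    p ∈ stoneCechHull (q ⁻¹' (J ∩ K)) :=
  stoneCechHull_inter_subset (hq.isClopen_preimage J) ⟨hJ, hK⟩

/-- Near a given point only one countable `J` matters, and one `N a` captures the trace of every `N
b` on `J`. Modulo finite sets, which remote points ignore, each `G b` is there contained in `G a`,
whose hull is closed. -/
theorem AlmostCoherent.isClosed_remote (hq : IsLocallyConstant q) {W : Type*} {N G : W → Set I}
    (hN : ∀ J : Set I, J.Countable → ∃ a, ∀ b, J ∩ N b ⊆ N a) (hG : AlmostCoherent N G) :
    IsClosed {y : countableHull q | y ∈ remoteHull q ∧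
      ∃ a, (y : StoneCech X) ∈ stoneCechHull (q ⁻¹' G a)} := by
  refine isClosed_iff_clusterPt.2 fun y hy => ?_
  have hyR : y ∈ remoteHull q := (isClosed_remoteHull hq).closure_subset_iff.2
    (fun _ h => h.1) (mem_closure_iff_clusterPt.2 hy)
  obtain ⟨J, hJ, hyJ⟩ := y.2
  obtain ⟨a, ha⟩ := hN J hJ
  refine ⟨hyR, a, ?_⟩
  refine ((isClopen_coe_preimage_hull hq (G a)).isClosed).closure_subset_iff.2 ?_
    (((isClopen_coe_preimage_hull hq J).isOpen.inter_closure)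
      ⟨hyJ, mem_closure_iff_clusterPt.2 hy⟩)
  rintro z ⟨hzJ, hzR, b, hzb⟩
  refine mem_hull_of_finite_diff hzR (inter_mem_hull hq hzJ hzb)
    ((hG.finite_diff b a).subset ?_)
  rintro i ⟨⟨hiJ, hib⟩, hia⟩
  exact ⟨⟨hib, ha b ⟨hiJ, hG.subset b hib⟩⟩, hia⟩

/-- Infinitely many exceptional sample points would have a cluster point along the cofinite filter.
It lies in the compact hull of `D` and is remote, hence in the open set `V` that the samples avoid.
-/
theorem finite_notMem_of_remote_subset (hq : IsLocallyConstant q) {x : I → X}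
    (hx : ∀ i, q (x i) = i) {D : Set I} (hD : D.Countable) {V : Set (countableHull q)}
    (hV : IsOpen V)
    (h : ∀ y ∈ remoteHull q, (y : StoneCech X) ∈ stoneCechHull (q ⁻¹' D) → y ∈ V) :
    (D ∩ {i | countableHullUnit q (x i) ∉ V}).Finite := by
  by_contra hinf
  set E := D ∩ {i | countableHullUnit q (x i) ∉ V}
  let l : Filter I := cofinite ⊓ 𝓟 E
  have : NeBot l := cofinite_inf_principal_neBot_iff.2 hinf
  have hE : ∀ᶠ i in l, i ∈ E := mem_inf_of_right (mem_principal_self E)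
  obtain ⟨y, hyD, hy⟩ := (isCompact_coe_preimage_hull (q := q) hD).exists_clusterPt
    (f := map (fun i => countableHullUnit q (x i)) l) (le_principal_iff.2 (hE.mono fun i hi =>
      stoneCechUnit_mem_hull (show q (x i) ∈ D from (hx i).symm ▸ hi.1)))
  have hfreq : ∀ U ∈ 𝓝 y, ∃ᶠ i in l, countableHullUnit q (x i) ∈ U := fun U hU =>
    (mapClusterPt_iff_frequently.1 hy) U hU
  refine (hfreq V (hV.mem_nhds (h y (fun F hF hyF => ?_) hyD))) (hE.mono fun i hi => hi.2)
  refine hfreq _ ((isClopen_coe_preimage_hull hq F).isOpen.mem_nhds hyF) ?_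
  filter_upwards [mem_inf_of_left hF.compl_mem_cofinite] with i hi hiF
  refine hi ?_
  have := (stoneCechUnit_mem_hull_iff (hq.isClopen_preimage F)).1 hiF
  rwa [mem_preimage, hx] at this

end CountableHull

theorem not_normalSpace_countableHull {X I : Type u} [TopologicalSpace X] {q : X → I}
    (hq : IsLocallyConstant q) (hsurj : Function.Surjective q) [Uncountable I] :
    ¬ NormalSpace (countableHull q) := by
  intro hnormal
  obtain ⟨W, N, G, hNc, hN, hG, hA⟩ := exists_almostCoherent_not_uniformizable I
  choose x hx using hsurj
  obtain ⟨U, V, hU, hV, hGU, hGV, hUV⟩ := normal_separation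
    (hG.isClosed_remote hq hN) (hG.sdiff.isClosed_remote hq hN) (by
      refine Set.disjoint_left.2 ?_
      rintro y ⟨hyR, a, ha⟩ ⟨-, b, hb⟩
      refine hyR _ ((hG.finite_diff a b).subset ?_) (inter_mem_hull hq ha hb)
      rintro i ⟨hia, hib, hib'⟩
      exact ⟨⟨hia, hib⟩, hib'⟩)
  obtain ⟨a, ha⟩ := hA {i | countableHullUnit q (x i) ∈ U}
  refine ha ⟨finite_notMem_of_remote_subset hq hx ((hNc a).mono (hG.subset a)) hU
    fun y hy hya => hGU ⟨hy, a, hya⟩, ?_⟩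
  refine (finite_notMem_of_remote_subset hq hx ((hNc a).mono (hG.sdiff.subset a)) hV
    fun y hy hya => hGV ⟨hy, a, hya⟩).subset ?_
  exact inter_subset_inter_right _ fun i hi => Set.disjoint_left.1 hUV hi

/-! ### Characters and uniqueness of `Y` -/

section Rigidity

variable {𝕜 : Type*} [RCLike 𝕜] {Y : Type*} [TopologicalSpace Y]

/-- A continuous function with compact support, as a function vanishing at infinity. -/
def zeroAtInftyOfCompactSupport (f : Y → 𝕜) (hf : Continuous f) (h : HasCompactSupport f) :
    C₀(Y, 𝕜) :=
  ⟨⟨f, hf⟩, h.is_zero_at_infty⟩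

theorem exists_zeroAtInfty_one_zero (𝕜 : Type*) [RCLike 𝕜] [T2Space Y] [LocallyCompactSpace Y]
    {K F : Set Y} (hK : IsCompact K) (hF : IsClosed F) (hKF : Disjoint K F) :
    ∃ f : C₀(Y, 𝕜), (∀ y ∈ K, f y = 1) ∧ ∀ y ∈ F, f y = 0 := by
  obtain ⟨f, hf₁, hf₀, hfc, -⟩ := exists_continuous_one_zero_of_isCompact hK hF hKF
  refine ⟨zeroAtInftyOfCompactSupport (fun y => (f y : 𝕜))
    (RCLike.continuous_ofReal.comp f.continuous) (hfc.comp_left RCLike.ofReal_zero),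
    fun y hy => ?_, fun y hy => ?_⟩
  · change (f y : 𝕜) = 1
    simp [hf₁ hy]
  · change (f y : 𝕜) = 0
    simp [hf₀ hy]

/-- If all functions vanishing at infinity have compact support, a nonzero character of their
algebra is the evaluation at a point. -/
theorem exists_forall_eq_apply_of_character [T2Space Y] [LocallyCompactSpace Y]
    (hY : ∀ f : C₀(Y, 𝕜), HasCompactSupport f) (χ : C₀(Y, 𝕜) →ₙₐ[𝕜] 𝕜) (hχ : ∃ f, χ f ≠ 0) :
    ∃ y, ∀ f, χ f = f y := by
  obtain ⟨f₀, hf₀⟩ : ∃ f, χ f = 1 := by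
    obtain ⟨f, hf⟩ := hχ
    exact ⟨(χ f)⁻¹ • f, by rw [map_smul, smul_eq_mul, inv_mul_cancel₀ hf]⟩
  obtain ⟨y, hy⟩ : ∃ y, ∀ f, χ f = 0 → f y = 0 := by
    by_contra! h
    -- Sums of functions `star f * f` from the kernel give a kernel element `k` that is positive on
    -- the compact support of `f₀`; then `f₀ = (f₀ / k) * k` is in the kernel, contradicting `χ f₀ =
    -- 1`.
    have hpos : ∃ (k : C₀(Y, 𝕜)) (g : Y → ℝ), χ k = 0 ∧ (∀ y, k y = (g y : 𝕜)) ∧ (∀ y, 0 ≤ g y) ∧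
        ∀ y ∈ tsupport f₀, 0 < g y := by
      refine (hY f₀).isCompact.induction_on (p := fun s => ∃ (k : C₀(Y, 𝕜)) (g : Y → ℝ), χ k = 0 ∧
        (∀ y, k y = (g y : 𝕜)) ∧ (∀ y, 0 ≤ g y) ∧ ∀ y ∈ s, 0 < g y) ?_ ?_ ?_ ?_
      · exact ⟨0, 0, map_zero χ, by simp, by simp, by simp⟩
      · rintro s t hst ⟨k, g, h₁, h₂, h₃, h₄⟩
        exact ⟨k, g, h₁, h₂, h₃, fun y hy => h₄ y (hst hy)⟩
      · rintro s t ⟨k, g, h₁, h₂, h₃, h₄⟩ ⟨k', g', h₁', h₂', h₃', h₄'⟩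
        refine ⟨k + k', g + g', by rw [map_add, h₁, h₁', add_zero], fun y => ?_,
          fun y => add_nonneg (h₃ y) (h₃' y), fun y hy => ?_⟩
        · simp [h₂, h₂']
        · rcases hy with hy | hy
          · exact add_pos_of_pos_of_nonneg (h₄ y hy) (h₃' y)
          · exact add_pos_of_nonneg_of_pos (h₃ y) (h₄' y hy)
      · intro y _
        obtain ⟨f, hf, hfy⟩ := h y
        refine ⟨{y | f y ≠ 0}, mem_nhdsWithin_of_mem_nhds
          ((isOpen_ne_fun (map_continuous f) continuous_const).mem_nhds hfy), star f * f,
          fun y => ‖f y‖ ^ 2, by rw [map_mul, hf, mul_zero], fun y => ?_, fun y => by positivity,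
          fun y (hy : f y ≠ 0) => by positivity⟩
        simp [RCLike.conj_mul]
    obtain ⟨k, g, hk, hkg, -, hg⟩ := hpos
    have hk0 : ∀ y ∈ tsupport f₀, k y ≠ 0 := fun y hy => by
      rw [hkg]
      exact_mod_cast (hg y hy).ne'
    have hsub : tsupport (fun y => f₀ y / k y) ⊆ tsupport f₀ :=
      closure_mono fun y (hy : f₀ y / k y ≠ 0) h0 => hy (by simp [show f₀ y = 0 from h0])
    have hcont : Continuous fun y => f₀ y / k y := continuous_of_tsupport fun y hy =>
      (map_continuous f₀).continuousAt.div (map_continuous k).continuousAt (hk0 y (hsub hy))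
    let d : C₀(Y, 𝕜) := zeroAtInftyOfCompactSupport _ hcont
      ((hY f₀).of_isClosed_subset (isClosed_tsupport _) hsub)
    have hd : f₀ = d * k := by
      ext y
      change f₀ y = f₀ y / k y * k y
      by_cases hy : f₀ y = 0
      · simp [hy]
      · rw [div_mul_cancel₀ _ (hk0 y (subset_tsupport _ hy))]
    rw [hd, map_mul, hk, mul_zero] at hf₀
    exact zero_ne_one hf₀
  have hc : ∀ f, f y = χ f * f₀ y := fun f => by
    have := hy (f - χ f • f₀) (by rw [map_sub, map_smul, hf₀, smul_eq_mul, mul_one, sub_self])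
    simpa [sub_eq_zero] using this
  have h₁ : f₀ y = 1 := by
    obtain ⟨f, hf, -⟩ := exists_zeroAtInfty_one_zero 𝕜 (isCompact_singleton (x := y)) isClosed_empty
      (disjoint_empty _)
    have hne : f₀ y ≠ 0 := fun h0 => by
      have := hc f
      rw [hf y rfl, h0, mul_zero] at this
      exact one_ne_zero this
    have := hc (f₀ * f₀)
    rw [map_mul, hf₀, one_mul, one_mul, ZeroAtInftyContinuousMap.mul_apply] at this
    exact mul_left_cancel₀ hne (by rw [this, mul_one])
  exact ⟨y, fun f => by rw [hc f, h₁, mul_one]⟩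

/-- Each `z` induces the character `f ↦ e f z`, which is evaluation at a point `τ z`. Urysohn
functions make `τ` a continuous bijection; it is proper because `e f` has norm one at the points of
`τ ⁻¹' K` when `f = 1` on `K`. -/
theorem nonempty_homeomorph_of_bijective [T2Space Y] [LocallyCompactSpace Y]
    {Z : Type*} [TopologicalSpace Z] [T2Space Z] [LocallyCompactSpace Z]
    (hY : ∀ f : C₀(Y, 𝕜), HasCompactSupport f) (e : C₀(Y, 𝕜) →ₙₐ[𝕜] C₀(Z, 𝕜))
    (he : Function.Bijective e) : Nonempty (Z ≃ₜ Y) := by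
  have hτ : ∀ z : Z, ∃ y : Y, ∀ f, e f z = f y := by
    intro z
    let χ : C₀(Y, 𝕜) →ₙₐ[𝕜] 𝕜 :=
      { toFun := fun f => e f z
        map_smul' := fun c f => by simp [map_smul]
        map_zero' := by simp
        map_add' := fun f g => by simp
        map_mul' := fun f g => by simp }
    refine exists_forall_eq_apply_of_character hY χ ?_
    obtain ⟨f, hf, -⟩ := exists_zeroAtInfty_one_zero 𝕜 (isCompact_singleton (x := z)) isClosed_empty
      (disjoint_empty _)
    obtain ⟨g, rfl⟩ := he.2 f
    exact ⟨g, by change e g z ≠ 0; simp [hf z rfl]⟩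
  choose τ hτ using hτ
  have hcont : Continuous τ := continuous_iff_continuousAt.2 fun z U hU => by
    obtain ⟨V, hVU, hV, hzV⟩ := mem_nhds_iff.1 hU
    obtain ⟨f, hf₁, hf₀⟩ := exists_zeroAtInfty_one_zero 𝕜 (isCompact_singleton (x := τ z))
      hV.isClosed_compl (disjoint_singleton_left.2 fun h => h hzV)
    have hz : e f z ≠ 0 := by simp [hτ, hf₁ _ rfl]
    rw [mem_map]
    filter_upwards [(isOpen_ne_fun (map_continuous (e f)) continuous_const).mem_nhds hz] with w hw
    refine hVU (by_contra fun hwV => hw ?_)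
    rw [hτ, hf₀ _ hwV]
  have hinj : Function.Injective τ := fun z w hzw => by
    by_contra hne
    obtain ⟨f, hf₁, hf₀⟩ := exists_zeroAtInfty_one_zero 𝕜 (isCompact_singleton (x := z))
      (isClosed_singleton (x := w)) (by simpa using hne)
    obtain ⟨g, rfl⟩ := he.2 f
    have h₁ := hf₁ z rfl
    rw [hτ, hzw, ← hτ, hf₀ w rfl] at h₁
    exact zero_ne_one h₁
  have hproper : IsProperMap τ := isProperMap_iff_isCompact_preimage.2 ⟨hcont, fun K hK => by
    obtain ⟨f, hf, -⟩ := exists_zeroAtInfty_one_zero 𝕜 hK isClosed_empty (disjoint_empty _)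
    have hlt : ∀ᶠ z in cocompact Z, ‖e f z‖ < 1 :=
      (e f).zero_at_infty'.norm.eventually_lt_const (by simp)
    obtain ⟨C, hC, hCsub⟩ := mem_cocompact.1 hlt
    refine hC.of_isClosed_subset (hK.isClosed.preimage hcont) fun z hz => by_contra fun hzC => ?_
    have : ‖e f z‖ < 1 := hCsub hzC
    rw [hτ, hf _ hz, norm_one] at this
    exact lt_irrefl _ this⟩
  have hsurj : Function.Surjective τ := fun y => by
    by_contra hy
    obtain ⟨f, hf₁, hf₀⟩ := exists_zeroAtInfty_one_zero 𝕜 (isCompact_singleton (x := y))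
      hproper.isClosedMap.isClosed_range (disjoint_singleton_left.2 hy)
    have hef : e f = e 0 := by
      ext z
      rw [hτ, hτ, hf₀ _ ⟨z, rfl⟩, ZeroAtInftyContinuousMap.zero_apply]
    have h₁ := hf₁ y rfl
    rw [he.1 hef] at h₁
    exact zero_ne_one h₁
  exact ⟨(Equiv.ofBijective τ ⟨hinj, hsurj⟩).toHomeomorphOfContinuousClosed hcont
    hproper.isClosedMap⟩

theorem cZeroAtInfty_eq_cCompactSupport (hY : ∀ f : C₀(Y, 𝕜), HasCompactSupport f) :
    CZeroAtInfty 𝕜 Y = CCompactSupport 𝕜 Y := by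
  ext f
  constructor
  · rintro ⟨g, rfl⟩
    exact hY g
  · intro hf
    exact ⟨zeroAtInftyOfCompactSupport f f.continuous hf, rfl⟩

end Rigidity

/-! ### Identification of `C_σ(X)` with `C₀(Y)` -/

section CSigma

variable {𝕜 : Type*} [RCLike 𝕜] {X I : Type*} [TopologicalSpace X] {q : X → I}

theorem mem_cSigma_iff (hq : IsLocallyConstant q) (hσ : ∀ i, IsSigmaCompact (q ⁻¹' {i}))
    {f : X →ᵇ 𝕜} :
    f ∈ CSigma 𝕜 X ↔ ∃ J : Set I, J.Countable ∧ ∀ x, q x ∉ J → f x = 0 := by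
  constructor
  · intro hf
    refine ⟨q '' tsupport f, IsSigmaCompact.countable_image_of_isLocallyConstant hq hf,
      fun x hx => ?_⟩
    exact image_eq_zero_of_notMem_tsupport fun h => hx ⟨x, h, rfl⟩
  · rintro ⟨J, hJ, hf⟩
    refine (isSigmaCompact_preimage_of_countable hσ hJ).of_isClosed_subset (isClosed_tsupport _) ?_
    exact closure_minimal (fun x hx => by_contra fun h => hx (hf x h))
      (hq.isClopen_preimage J).isClosed

/-- `C_σ(X)` as a subalgebra. -/
def cSigmaSubalgebra (𝕜 : Type*) [RCLike 𝕜] (hq : IsLocallyConstant q)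
    (hσ : ∀ i, IsSigmaCompact (q ⁻¹' {i})) : NonUnitalSubalgebra 𝕜 (X →ᵇ 𝕜) where
  carrier := CSigma 𝕜 X
  zero_mem' := (mem_cSigma_iff hq hσ).2 ⟨∅, countable_empty, fun _ _ => rfl⟩
  add_mem' := by
    intro f g hf hg
    obtain ⟨J, hJ, hf⟩ := (mem_cSigma_iff hq hσ).1 hf
    obtain ⟨K, hK, hg⟩ := (mem_cSigma_iff hq hσ).1 hg
    refine (mem_cSigma_iff hq hσ).2 ⟨J ∪ K, hJ.union hK, fun x hx => ?_⟩
    rw [mem_union, not_or] at hx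
    simp [hf x hx.1, hg x hx.2]
  mul_mem' := by
    intro f g hf _
    obtain ⟨J, hJ, hf⟩ := (mem_cSigma_iff hq hσ).1 hf
    exact (mem_cSigma_iff hq hσ).2 ⟨J, hJ, fun x hx => by simp [hf x hx]⟩
  smul_mem' := by
    intro c f hf
    obtain ⟨J, hJ, hf⟩ := (mem_cSigma_iff hq hσ).1 hf
    exact (mem_cSigma_iff hq hσ).2 ⟨J, hJ, fun x hx => by simp [hf x hx]⟩

theorem isClosed_cSigma (hq : IsLocallyConstant q) (hσ : ∀ i, IsSigmaCompact (q ⁻¹' {i})) :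
    IsClosed (CSigma 𝕜 X) := by
  refine isClosed_of_closure_subset fun f hf => ?_
  obtain ⟨F, hF, hlim⟩ := mem_closure_iff_seq_limit.1 hf
  choose J hJ hFJ using fun n => (mem_cSigma_iff hq hσ).1 (hF n)
  refine (mem_cSigma_iff hq hσ).2 ⟨⋃ n, J n, countable_iUnion hJ, fun x hx => ?_⟩
  have h := ((continuous_eval_const (F := X →ᵇ 𝕜) x).tendsto f).comp hlim
  refine tendsto_nhds_unique h (tendsto_const_nhds.congr fun n => ?_)
  exact (hFJ n x fun h => hx (mem_iUnion.2 ⟨n, h⟩)).symm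

theorem exists_continuousMap_stoneCech_eq (f : X →ᵇ 𝕜) :
    ∃ F : C(StoneCech X, 𝕜), ∀ x, F (stoneCechUnit x) = f x := by
  let g : X → Metric.closedBall (0 : 𝕜) ‖f‖ := fun x => ⟨f x, by simpa using f.norm_coe_le_norm x⟩
  have hg : Continuous g := f.continuous.subtype_mk _
  have : CompactSpace (Metric.closedBall (0 : 𝕜) ‖f‖) :=
    isCompact_iff_compactSpace.1 (isCompact_closedBall _ _)
  exact ⟨⟨fun p => (stoneCechExtend hg p : Metric.closedBall (0 : 𝕜) ‖f‖), continuous_subtype_val.comp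
    (continuous_stoneCechExtend hg)⟩, fun x => congrArg Subtype.val
      (stoneCechExtend_stoneCechUnit hg x)⟩

theorem exists_countable_forall_notMem_hull_eq_zero (hq : IsLocallyConstant q)
    (f : C₀(countableHull q, 𝕜)) : ∃ J : Set I, J.Countable ∧
      ∀ y : countableHull q, (y : StoneCech X) ∉ stoneCechHull (q ⁻¹' J) → f y = 0 := by
  have hC : ∀ n : ℕ, ∃ C : Set (countableHull q), IsCompact C ∧
      ∀ y ∉ C, ‖f y‖ < 1 / ((n : ℝ) + 1) := fun n => by
    have hlt : ∀ᶠ y in cocompact (countableHull q), ‖f y‖ < 1 / ((n : ℝ) + 1) :=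
      f.zero_at_infty'.norm.eventually_lt_const (by rw [norm_zero]; positivity)
    obtain ⟨C, hC, h⟩ := mem_cocompact.1 hlt
    exact ⟨C, hC, fun y hy => h hy⟩
  choose C hC hCf using hC
  choose J hJ hCJ using fun n => exists_countable_subset_of_isCompact hq (hC n)
  refine ⟨⋃ n, J n, countable_iUnion hJ, fun y hy => by_contra fun h => ?_⟩
  obtain ⟨n, hn⟩ := exists_nat_one_div_lt (norm_pos_iff.2 h)
  refine (hCf n y fun hyC => hy ?_).not_gt hn
  exact stoneCechHull_mono (preimage_mono (subset_iUnion J n)) (hCJ n hyC)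

theorem hasCompactSupport_countableHull (hq : IsLocallyConstant q)
    (f : C₀(countableHull q, 𝕜)) : HasCompactSupport f := by
  obtain ⟨J, hJ, h⟩ := exists_countable_forall_notMem_hull_eq_zero hq f
  exact HasCompactSupport.intro (isCompact_coe_preimage_hull hJ) h

/-- Restriction of functions from the countable hull to `X`. -/
noncomputable def restrictCountableHull (𝕜 : Type*) [RCLike 𝕜] (hq : IsLocallyConstant q)
    (hσ : ∀ i, IsSigmaCompact (q ⁻¹' {i})) :
    C₀(countableHull q, 𝕜) →ₙₐ[𝕜] cSigmaSubalgebra 𝕜 hq hσ where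
  toFun f := ⟨f.toBCF.compContinuous ⟨_, continuous_countableHullUnit⟩, by
    obtain ⟨J, hJ, h⟩ := exists_countable_forall_notMem_hull_eq_zero hq f
    exact (mem_cSigma_iff hq hσ).2 ⟨J, hJ, fun x hx => h _ fun hmem =>
      hx ((stoneCechUnit_mem_hull_iff (hq.isClopen_preimage J)).1 hmem)⟩⟩
  map_smul' _ _ := rfl
  map_zero' := rfl
  map_add' _ _ := rfl
  map_mul' _ _ := rfl

theorem isometry_restrictCountableHull (hq : IsLocallyConstant q)
    (hσ : ∀ i, IsSigmaCompact (q ⁻¹' {i})) : Isometry (restrictCountableHull 𝕜 hq hσ) := by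
  refine AddMonoidHomClass.isometry_of_norm _ fun f => ?_
  have hval : ∀ x, (restrictCountableHull 𝕜 hq hσ f : X →ᵇ 𝕜) x = f (countableHullUnit q x) :=
    fun _ => rfl
  change ‖(restrictCountableHull 𝕜 hq hσ f : X →ᵇ 𝕜)‖ = ‖f.toBCF‖
  refine le_antisymm ((BoundedContinuousFunction.norm_le (norm_nonneg _)).2 fun x =>
    f.toBCF.norm_coe_le_norm _) ((BoundedContinuousFunction.norm_le (norm_nonneg _)).2 fun y => ?_)
  refine (denseRange_countableHullUnit hq).induction_on y
    (isClosed_le f.toBCF.continuous.norm continuous_const) fun x => ?_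
  exact (restrictCountableHull 𝕜 hq hσ f : X →ᵇ 𝕜).norm_coe_le_norm x

theorem surjective_restrictCountableHull (hq : IsLocallyConstant q)
    (hσ : ∀ i, IsSigmaCompact (q ⁻¹' {i})) :
    Function.Surjective (restrictCountableHull 𝕜 hq hσ) := by
  rintro ⟨f, hf⟩
  obtain ⟨J, hJ, hfJ⟩ := (mem_cSigma_iff hq hσ).1 hf
  obtain ⟨F, hF⟩ := exists_continuousMap_stoneCech_eq f
  have hzero : ∀ y : countableHull q, (y : StoneCech X) ∉ stoneCechHull (q ⁻¹' J) →
      F y = 0 := by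
    intro y hy
    -- The hulls of `q ⁻¹' J` and of its complement cover `Y`, and the extension `F` vanishes on the
    -- latter by continuity.
    have hcl : stoneCechHull (q ⁻¹' Jᶜ) ⊆ {p | F p = 0} := by
      refine closure_minimal ?_ (isClosed_eq F.continuous continuous_const)
      rintro _ ⟨x, hx, rfl⟩
      exact (hF x).trans (hfJ x hx)
    obtain ⟨K, hK, hyK⟩ := y.2
    have := stoneCechHull_mono (subset_univ _) hyK
    rw [← union_compl_self (q ⁻¹' J), stoneCechHull_union] at this
    exact hcl (this.resolve_left hy)
  refine ⟨zeroAtInftyOfCompactSupport (fun y : countableHull q => F y)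
    (F.continuous.comp continuous_subtype_val)
    (HasCompactSupport.intro (isCompact_coe_preimage_hull hJ) hzero), ?_⟩
  ext x
  exact hF x

end CSigma

end

theorem theorem5p2 (𝕜 : Type w) [RCLike 𝕜] (X : Type u) [TopologicalSpace X]
    [TopologicalSpace.MetrizableSpace X] [LocallyCompactSpace X] :
    ∃ A : NonUnitalSubalgebra 𝕜 (X →ᵇ 𝕜),
      (A : Set (X →ᵇ 𝕜)) = CSigma 𝕜 X ∧
      CompleteSpace A ∧
      ∃ (Y : Type u) (_ : TopologicalSpace Y),
        T2Space Y ∧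
        LocallyCompactSpace Y ∧
        IsometricallyIsomorphic 𝕜 A C₀(Y, 𝕜) ∧
        (∀ (Z : Type v) [TopologicalSpace Z] [T2Space Z] [LocallyCompactSpace Z],
          IsometricallyIsomorphic 𝕜 A C₀(Z, 𝕜) → Nonempty (Z ≃ₜ Y)) ∧
        CountablyCompactSpace Y ∧
        (¬ SigmaCompactSpace X → ¬ NormalSpace Y) ∧
        CZeroAtInfty 𝕜 Y = CCompactSupport 𝕜 Y := by
  let _ : MetricSpace X := TopologicalSpace.metrizableSpaceMetric X
  obtain ⟨I, q, hq, hsurj, hσ⟩ := exists_isLocallyConstant_isSigmaCompact_fiber X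
  have : LocallyCompactSpace (countableHull q) := (isOpen_countableHull hq).locallyCompactSpace
  have hcs := hasCompactSupport_countableHull (𝕜 := 𝕜) hq
  have hiso := isometry_restrictCountableHull (𝕜 := 𝕜) hq hσ
  have hbij : Function.Bijective (restrictCountableHull 𝕜 hq hσ) :=
    ⟨hiso.injective, surjective_restrictCountableHull hq hσ⟩
  refine ⟨cSigmaSubalgebra 𝕜 hq hσ, rfl,
    (isClosed_cSigma (𝕜 := 𝕜) hq hσ).isComplete.completeSpace_coe, countableHull q, inferInstance,
    inferInstance, inferInstance, ?_, ?_, countablyCompactSpace_countableHull, ?_,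
    cZeroAtInfty_eq_cCompactSupport hcs⟩
  · obtain ⟨g, hg₁, hg₂⟩ := Function.bijective_iff_has_inverse.1 hbij
    exact ⟨(restrictCountableHull 𝕜 hq hσ).inverse g hg₁ hg₂, ⟨hg₂.injective, hg₁.surjective⟩,
      hiso.right_inv hg₂⟩
  · rintro Z _ _ _ ⟨ψ, hψ, -⟩
    exact nonempty_homeomorph_of_bijective hcs (ψ.comp (restrictCountableHull 𝕜 hq hσ))
      (hψ.comp hbij)
  · intro hX
    have : Uncountable I := by
      refine not_countable_iff.1 fun hI => hX (isSigmaCompact_univ_iff.1 ?_)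
      exact isSigmaCompact_preimage_of_countable hσ Set.countable_univ
    exact not_normalSpace_countableHull hq hsurj
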